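/- Let $n,m\ge 1$ be integers and let $H=\{x\in\mathbb R^n:\sum_i x_i=0\}$, with orthogonal projection $\pi:\mathbb R^n\to H$. Consider walks in $H$ all of whose points lie in the open alcove $x_1>x_2>\cdots>x_n>x_1-m$ of the rescaled affine Weyl group $m\tilde A_{n-1}$. For $0<p<n$ let $\check\omega_p\in H$ be the fundamental weight of $A_{n-1}$, with $p$ coordinates $(n-p)/n$ followed by $n-p$ coordinates $-p/n$; the Weyl group is $S_n$, permuting coordinates. The coordinate step set consists of the $2n$ vectors $\pi(e_i)$, $\pi(-e_i)$ ($1\le i\le n$), counted with multiplicity. The vectors $\pi(e_i)$ are the Weyl images of $\check\omega_1$ and the vectors $\pi(-e_i)$ those of $\check\omega_{n-1}$ (for $n=1$ both are the zero vector). The diagonal step set consists of the $2^n$ vectors $\pi(\pm\frac12,\ldots,\pm\frac12)$, counted with multiplicity: these are all Weyl images of $\check\omega_1,\ldots,\check\omega_{n-1}$, each once, together with the zero step with multiplicity two. Let $\eta,\lambda\in\mathbb R^n$ be such that $\pi(\eta)$ and $\pi(\lambda)$ lie in the alcove, let $b_{\eta\lambda,k}$ be the number of $k$-step walks from $\pi(\eta)$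 to $\pi(\lambda)$ staying in the alcove, with steps from the step set under consideration, and let $s$ be the index for which $\lambda_s$ is the smallest coordinate of $\lambda$ (so in fact $s=n$). (1) Coordinate steps. Suppose $\lambda_j-\eta_i\in\mathbb Z$ for all $i,j$. With $\zeta=e^{2\pi i/(mn)}$, for every $x\in\mathbb C$ the following series converges and $$\sum_{k\ge 0} b_{\eta\lambda,k}\frac{x^k}{k!}=\sum_{c=0}^{m-1}\frac1n\sum_{u=0}^{n-1}\zeta^{-ums}\det_{n\times n}\left|\frac1m\sum_{r=0}^{m-1}\zeta^{-(u+nr)(\lambda_j-\eta_i-c)}\exp\bigl(2x\cos(2\pi(u+nr)/(mn))\bigr)\right|.$$ (2) Diagonal steps. Let $k\ge0$ and suppose $\lambda_j-\eta_i-k/2\in\mathbb Z$ for all $i,j$. With $\zeta=e^{2\pi i/(2mn)}$, where $\zeta^a$ means $e^{2\pi i a/(2mn)}$ for real $a$, $$b_{\eta\lambda,k}=\sum_{c=0}^{m-1}\frac1n\sum_{u=0}^{n-1}\zeta^{-2ums}\det_{n\times n}\left|\frac{2^{k-1}}m\sum_{r=0}^{2m-1}\zeta^{-2(u+nr)(\lambda_j-\eta_i-c)}\cos^k(\pi(u+nr)/(mn))\right|.$$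 -/

import Mathlib

namespace AlcoveWalk

/-- Orthogonal projection of `ℝⁿ` onto the hyperplane `∑ xᵢ = 0`. -/
noncomputable def proj {n : ℕ} (x : Fin n → ℝ) : Fin n → ℝ :=
  fun i => x i - (∑ j, x j) / n

/-- The alcove `x₁ > x₂ > ⋯ > xₙ > x₁ - m` of `m·Ã_{n-1}` (open) in the hyperplane `∑ xᵢ = 0`. -/
def alcove (n m : ℕ) : Set (Fin n → ℝ) :=
  {x | ∑ i, x i = 0 ∧ (∀ i j, i < j → x j < x i) ∧
    ∀ h : 0 < n, x ⟨0, h⟩ - m < x ⟨n - 1, Nat.sub_lt h one_pos⟩}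

/-- Position after `t` steps of the walk which starts at `a` and whose successive steps are
`step (w 0), step (w 1), …`. -/
noncomputable def position {n k : ℕ} {ι : Type*} (step : ι → Fin n → ℝ) (a : Fin n → ℝ)
    (w : Fin k → ι) (t : ℕ) : Fin n → ℝ :=
  a + ∑ i : Fin k, if (i : ℕ) < t then step (w i) else 0

/-- The number of `k`-step walks from `a` to `b`, with steps from the family `step`, all of whose
`k + 1` points lie in `C`. A step occurring several times in the family counts with that
multiplicity. -/
noncomputable def walkCount {n : ℕ} {ι : Type*} (C : Set (Fin n → ℝ)) (step : ι → Fin n → ℝ)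
    (a b : Fin n → ℝ) (k : ℕ) : ℕ :=
  Nat.card {w : Fin k → ι // (∀ t ≤ k, position step a w t ∈ C) ∧ position step a w k = b}

/-- The `2n` projected coordinate steps: the projections of `e_i` (`true`) and `-e_i` (`false`). -/
noncomputable def coordStep (n : ℕ) (p : Fin n × Bool) : Fin n → ℝ :=
  proj (Pi.single p.1 (if p.2 then 1 else -1))

/-- The `2ⁿ` projected diagonal steps: the projections of `(±1/2, …, ±1/2)`. -/
noncomputable def diagStep (n : ℕ) (ε : Fin n → Bool) : Fin n → ℝ :=
  proj (fun i => if ε i then 1 / 2 else -(1 / 2))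

/-- The fundamental weight `ω̌_p` of `A_{n-1}` (for `0 < p < n`): `p` coordinates `(n-p)/n` followed
by `n-p` coordinates `-p/n`. -/
noncomputable def fundWeight (n p : ℕ) : Fin n → ℝ :=
  fun i => if (i : ℕ) < p then ((n : ℝ) - p) / n else -(p / n)

/-- For `0 < p < n` the vector `fundWeight n p` is the element of the hyperplane `∑ xᵢ = 0` dual to
the `p`-th simple root `e_p - e_{p+1}` (the index `i` below is zero-based). -/
theorem fundWeight_dual (n p : ℕ) (hpn : p < n) :
    ∑ i, fundWeight n p i = 0 ∧ ∀ (i : ℕ) (hi : i + 1 < n),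
      fundWeight n p ⟨i, Nat.lt_of_succ_lt hi⟩ - fundWeight n p ⟨i + 1, hi⟩ =
        if i + 1 = p then 1 else 0 := by
  have hn : (n : ℝ) ≠ 0 := by
    have : n ≠ 0 := by omega
    exact_mod_cast this
  constructor
  · have h : ∀ i : Fin n, fundWeight n p i = (if (i : ℕ) < p then (1 : ℝ) else 0) - p / n := by
      intro i
      unfold fundWeight
      split_ifs
      · field_simp
      · ring
    have hc : ∑ i : Fin n, (if (i : ℕ) < p then (1 : ℝ) else 0) = p := by
      rw [Fin.sum_univ_eq_sum_range (fun i => if i < p then (1 : ℝ) else 0) n,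
        Finset.sum_ite, Finset.sum_const_zero, add_zero, Finset.sum_const, nsmul_eq_mul, mul_one]
      have : (Finset.range n).filter (fun x => x < p) = Finset.range p := by
        ext x
        simp only [Finset.mem_filter, Finset.mem_range]
        omega
      rw [this, Finset.card_range]
    rw [Finset.sum_congr rfl (fun i _ => h i), Finset.sum_sub_distrib, hc]
    simp only [Finset.sum_const, Finset.card_univ, Fintype.card_fin, nsmul_eq_mul]
    field_simp
    ring
  · intro i hi
    unfold fundWeight
    dsimp only
    split_ifs <;> first | omega | (field_simp; ring)

/-- The orbit of `v` under the Weyl group `S_n` of `A_{n-1}`, permuting coordinates. -/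
def weylOrbit {n : ℕ} (v : Fin n → ℝ) : Set (Fin n → ℝ) :=
  Set.range fun σ : Equiv.Perm (Fin n) => v ∘ σ

/-- The power `ζ^a` of `ζ = exp(2πi/N)`, for a real exponent `a`. -/
noncomputable def zetaPow (N : ℕ) (a : ℝ) : ℂ :=
  Complex.exp (2 * Real.pi * Complex.I * a / N)

/-- The finite sum of determinants for the projected coordinate steps; here `ζ = exp(2πi/(mn))`,
and `s` is the one-based index of the smallest coordinate of `lam`. -/
noncomputable def coordFormula (n m s : ℕ) (eta lam : Fin n → ℝ) (x : ℂ) : ℂ :=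
  ∑ c ∈ Finset.range m, (1 / (n : ℂ)) * ∑ u ∈ Finset.range n,
    zetaPow (m * n) (-((u : ℝ) * m * s)) *
      (Matrix.of fun i j : Fin n =>
        (1 / (m : ℂ)) * ∑ r ∈ Finset.range m,
          zetaPow (m * n) (-(((u : ℝ) + n * r) * (lam j - eta i - c))) *
            Complex.exp (2 * x * (Real.cos (2 * Real.pi * (u + n * r) / (m * n)) : ℂ))).det

/-- The finite sum of determinants for the projected diagonal steps; here `ζ = exp(2πi/(2mn))`. -/
noncomputable def diagFormula (n m s : ℕ) (eta lam : Fin n → ℝ) (k : ℕ) : ℂ :=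
  ∑ c ∈ Finset.range m, (1 / (n : ℂ)) * ∑ u ∈ Finset.range n,
    zetaPow (2 * m * n) (-(2 * (u : ℝ) * m * s)) *
      (Matrix.of fun i j : Fin n =>
        ((2 : ℂ) ^ k / (2 * m)) * ∑ r ∈ Finset.range (2 * m),
          zetaPow (2 * m * n) (-(2 * ((u : ℝ) + n * r) * (lam j - eta i - c))) *
            (Real.cos (Real.pi * (u + n * r) / (m * n)) : ℂ) ^ k).det

end AlcoveWalk

/-!
The formulas are an instance of the reflection principle for the affine Weyl group of type
`A_{n-1}`, in transfer-matrix form. Lift a walk in the alcove to a walk in `ℝⁿ` with unprojected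
steps. The number of walks of length `k` from `proj eta` to `proj lam` is, as a function of `k` and
`lam`, determined by its values at `k = 0`, by the recurrence over the last step (`walkCount_succ`)
and by its vanishing outside the alcove.

The other side is a superposition (`waveSum`) of determinants of characters (`wave`). Each `wave` is
an eigenfunction of translation by any vector, so the superposition weighted by `k`-th powers of
the eigenvalues obeys the recurrence of the free walk (`waveSum_succ`). Exchanging two momenta shows
that it vanishes on every wall of the affine Weyl group (`waveSum_eq_zero`). The coordinates of a
step differ by integers of absolute value at most one, and the coordinates of all points reached
differ by integers, so a walk cannot leave the alcove without stopping on a wall; hence the two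
recurrences agree in the alcove (`walkCount_eq_waveSum`). For `k = 0`, the sums over the momenta are
root-of-unity filters, which leave a signed count of the elements of the affine Weyl group, extended
by multiples of `(1, …, 1)`, that carry `eta` to `lam` (`waveSum_zero`). Since the alcove is a
fundamental domain (`eq_of_affine_congruent`), this count is `1` if `proj eta = proj lam` and `0`
otherwise (`waveSum_zero_eq_ite`).

Multilinearity of the determinant (`det_sum_zetaPow`) identifies the superposition with the
determinants in the closed formulas: for diagonal steps the eigenvalue is a product over the
coordinates, so its `k`-th power distributes over the columns; for coordinate steps it is a sum, and
its exponential does.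
-/

namespace AlcoveWalk

/-! ### Powers of the root of unity -/

theorem zetaPow_zero (N : ℕ) : zetaPow N 0 = 1 := by
  simp [zetaPow]

theorem zetaPow_add (N : ℕ) (a b : ℝ) : zetaPow N (a + b) = zetaPow N a * zetaPow N b := by
  rw [zetaPow, zetaPow, zetaPow, ← Complex.exp_add]
  push_cast
  ring_nf

theorem zetaPow_sum (N : ℕ) {ι : Type*} (s : Finset ι) (a : ι → ℝ) :
    zetaPow N (∑ i ∈ s, a i) = ∏ i ∈ s, zetaPow N (a i) := by
  classical
  induction s using Finset.induction_on with
  | empty => simp [zetaPow_zero]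
  | insert i s hi ih => rw [Finset.sum_insert hi, Finset.prod_insert hi, zetaPow_add, ih]

theorem zetaPow_mul_mul {M : ℕ} (hM : 0 < M) (N : ℕ) (a : ℝ) :
    zetaPow (M * N) (M * a) = zetaPow N a := by
  have : (M : ℂ) ≠ 0 := by exact_mod_cast hM.ne'
  rw [zetaPow, zetaPow]
  congr 1
  push_cast
  rw [show 2 * (Real.pi : ℂ) * Complex.I * (M * a) = M * (2 * Real.pi * Complex.I * a) by ring,
    mul_div_mul_left _ _ this]

theorem zetaPow_intCast {N : ℕ} (z : ℤ) :
    zetaPow N z = Complex.exp (2 * Real.pi * Complex.I / N) ^ z := by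
  rw [← Complex.exp_int_mul, zetaPow]
  congr 1
  push_cast
  ring

theorem zetaPow_intCast_eq_one_iff {N : ℕ} (hN : 0 < N) (z : ℤ) :
    zetaPow N z = 1 ↔ (N : ℤ) ∣ z := by
  rw [zetaPow_intCast]
  exact (Complex.isPrimitiveRoot_exp N hN.ne').zpow_eq_one_iff_dvd z

theorem zetaPow_add_zetaPow_neg (N : ℕ) (a : ℝ) :
    zetaPow N a + zetaPow N (-a) = 2 * (Real.cos (2 * Real.pi * a / N) : ℂ) := by
  rw [Complex.ofReal_cos, Complex.two_cos, zetaPow, zetaPow]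
  congr 2 <;> push_cast <;> ring

/-- Orthogonality of the characters of `ℤ/M`, summed over any number of full periods. -/
theorem sum_range_zetaPow {M R : ℕ} (hM : 0 < M) (hR : M ∣ R) (z : ℤ) :
    ∑ r ∈ Finset.range R, zetaPow M (-(r * z)) = if (M : ℤ) ∣ z then (R : ℂ) else 0 := by
  have hpow : ∀ r : ℕ, zetaPow M (-(r * z)) = zetaPow M ((-z : ℤ) : ℝ) ^ r := by
    intro r
    rw [zetaPow_intCast, ← zpow_natCast, ← zpow_mul, ← zetaPow_intCast]
    push_cast
    ring_nf
  simp_rw [hpow]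
  split_ifs with h
  · rw [(zetaPow_intCast_eq_one_iff hM _).2 ((dvd_neg).2 h)]
    simp
  · have h1 : zetaPow M ((-z : ℤ) : ℝ) ≠ 1 := fun h' =>
      h ((dvd_neg).1 ((zetaPow_intCast_eq_one_iff hM _).1 h'))
    have hR1 : zetaPow M ((-z : ℤ) : ℝ) ^ R = 1 := by
      rw [← hpow, show -((R : ℝ) * z) = ((-(R * z) : ℤ) : ℝ) by push_cast; ring,
        zetaPow_intCast_eq_one_iff hM]
      exact (dvd_neg).2 (Dvd.dvd.mul_right (by exact_mod_cast hR) _)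
    rw [geom_sum_eq h1, hR1, sub_self, zero_div]

/-! ### Projection and alcove -/

theorem proj_sub {n : ℕ} (x y : Fin n → ℝ) : proj (x - y) = proj x - proj y := by
  funext i
  simp only [proj, Pi.sub_apply, Finset.sum_sub_distrib]
  ring

theorem sum_proj {n : ℕ} (x : Fin n → ℝ) : ∑ i, proj x i = 0 := by
  rcases Nat.eq_zero_or_pos n with rfl | hn
  · simp
  · have : (n : ℝ) ≠ 0 := by exact_mod_cast hn.ne'
    simp only [proj, Finset.sum_sub_distrib, Finset.sum_const, Finset.card_univ,
      Fintype.card_fin, nsmul_eq_mul]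
    field_simp
    ring

theorem proj_eq_proj_iff {n : ℕ} (hn : 0 < n) (x y : Fin n → ℝ) :
    proj x = proj y ↔ ∃ t : ℝ, ∀ i, x i = y i + t := by
  constructor
  · intro h
    refine ⟨(∑ j, x j) / n - (∑ j, y j) / n, fun i => ?_⟩
    have := congrFun h i
    simp only [proj] at this
    linarith
  · rintro ⟨t, ht⟩
    have : (n : ℝ) ≠ 0 := by exact_mod_cast hn.ne'
    funext i
    simp only [proj, ht, Finset.sum_add_distrib, Finset.sum_const, Finset.card_univ,
      Fintype.card_fin, nsmul_eq_mul]
    field_simp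
    ring

theorem proj_mem_alcove_iff {n m : ℕ} (x : Fin n → ℝ) :
    proj x ∈ alcove n m ↔ (∀ i j, i < j → x j < x i) ∧
      ∀ h : 0 < n, x ⟨0, h⟩ - m < x ⟨n - 1, Nat.sub_lt h one_pos⟩ := by
  simp only [alcove, Set.mem_ofPred_eq, sum_proj, true_and]
  simp only [proj, sub_lt_sub_iff_right]
  refine and_congr_right fun _ => forall_congr' fun h => ?_
  constructor <;> intro h <;> linarith

theorem sub_lt_of_proj_mem_alcove {n m : ℕ} {x : Fin n → ℝ} (hx : proj x ∈ alcove n m)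
    (i j : Fin n) : x i - x j < m := by
  have hn : 0 < n := i.pos
  rw [proj_mem_alcove_iff] at hx
  have h := hx.2 hn
  have hanti : StrictAnti x := fun a b hab => hx.1 a b hab
  have h0 : x i ≤ x ⟨0, hn⟩ := hanti.antitone (Fin.mk_le_of_le_val (Nat.zero_le _))
  have h1 : x ⟨n - 1, Nat.sub_lt hn one_pos⟩ ≤ x j :=
    hanti.antitone (Fin.le_def.2 (Nat.le_sub_one_of_lt j.2))
  linarith

/-- Two vectors of the alcove which agree up to a permutation and a translation by `m` times an
integer vector differ only by a multiple of `(1, …, 1)`, as soon as the coordinate sum of the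
integer vector is divisible by `n`: they are congruent under the affine Weyl group modulo the
diagonal, and the alcove is a fundamental domain. -/
theorem eq_of_affine_congruent {n m : ℕ} {x y : Fin n → ℝ} (hx : proj x ∈ alcove n m)
    (hy : proj y ∈ alcove n m) (σ : Equiv.Perm (Fin n)) (v : Fin n → ℤ) (q : ℤ) (c : ℝ)
    (hv : ∑ j, v j = n * q) (h : ∀ j, x j = y (σ j) + c + m * v j) :
    σ = 1 ∧ ∀ j, x j = y j + (c + m * q) := by
  have hsum : ∑ j, (v j - q) = 0 := by
    simp [Finset.sum_sub_distrib, hv]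
  have hvq : ∀ j, v j = q := by
    by_contra! hne
    obtain ⟨j₀, hj₀⟩ := hne
    have hne' : ∃ j ∈ Finset.univ, v j - q ≠ 0 := ⟨j₀, Finset.mem_univ _, sub_ne_zero.2 hj₀⟩
    obtain ⟨j, -, hj⟩ := Finset.exists_pos_of_sum_zero_of_exists_nonzero _ hsum hne'
    obtain ⟨l, -, hl⟩ := Finset.exists_pos_of_sum_zero_of_exists_nonzero (fun j => -(v j - q))
      (by rw [Finset.sum_neg_distrib, hsum, neg_zero])
      ⟨j₀, Finset.mem_univ _, neg_ne_zero.2 (sub_ne_zero.2 hj₀)⟩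
    -- the integers `v j` and `v l` differ by at least two, the coordinates by less than `m`
    have h2 : (v l : ℝ) + 2 ≤ v j := by
      have : v l + 2 ≤ v j := by omega
      exact_mod_cast this
    have h3 := sub_lt_of_proj_mem_alcove hx j l
    have h4 := sub_lt_of_proj_mem_alcove hy (σ l) (σ j)
    have h5 : (m : ℝ) * (v l + 2) ≤ m * v j := mul_le_mul_of_nonneg_left h2 (Nat.cast_nonneg m)
    have h6 := h j
    have h7 := h l
    nlinarith
  have hanti : StrictAnti x := fun a b hab => ((proj_mem_alcove_iff x).1 hx).1 a b hab
  have hanti' : StrictAnti y := fun a b hab => ((proj_mem_alcove_iff y).1 hy).1 a b hab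
  have hmono : StrictMono σ := by
    intro a b hab
    have := hanti hab
    rw [h a, h b, hvq, hvq] at this
    exact hanti'.lt_iff_gt.1 (by linarith)
  have hσ : σ = 1 := by
    ext i
    have := congrArg (fun f => ((f i : Fin n) : ℕ)) (Subsingleton.elim
      (hmono.orderIsoOfSurjective σ σ.surjective) (OrderIso.refl (Fin n)))
    simpa using this
  refine ⟨hσ, fun j => ?_⟩
  rw [h j, hvq, hσ, Equiv.Perm.one_apply]
  ring

/-! ### Counting walks by their last step -/

theorem position_self {n k : ℕ} {ι : Type*} (step : ι → Fin n → ℝ) (a : Fin n → ℝ)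
    (w : Fin k → ι) : position step a w k = a + ∑ i, step (w i) := by
  simp [position]

theorem position_snoc {n k : ℕ} {ι : Type*} (step : ι → Fin n → ℝ) (a : Fin n → ℝ)
    (w : Fin k → ι) (e : ι) {t : ℕ} (ht : t ≤ k) :
    position step a (Fin.snoc w e : Fin (k + 1) → ι) t = position step a w t := by
  simp [position, Fin.sum_univ_castSucc, ht.not_gt]

theorem position_snoc_last {n k : ℕ} {ι : Type*} (step : ι → Fin n → ℝ) (a : Fin n → ℝ)
    (w : Fin k → ι) (e : ι) :
    position step a (Fin.snoc w e : Fin (k + 1) → ι) (k + 1) = position step a w k + step e := by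
  simp [position_self, Fin.sum_univ_castSucc, add_assoc]

theorem walkCount_zero {n : ℕ} {ι : Type*} {C : Set (Fin n → ℝ)} (step : ι → Fin n → ℝ)
    {a : Fin n → ℝ} (ha : a ∈ C) (b : Fin n → ℝ) [Decidable (a = b)] :
    walkCount C step a b 0 = if a = b then 1 else 0 := by
  have hpos : ∀ (w : Fin 0 → ι) t, position step a w t = a := fun w t => by simp [position]
  unfold walkCount
  split_ifs with h
  · rw [Nat.card_eq_one_iff_unique]
    refine ⟨⟨fun x y => Subtype.ext (Subsingleton.elim _ _)⟩, ⟨⟨Fin.elim0, ?_⟩⟩⟩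
    exact ⟨fun t _ => by rwa [hpos], by rw [hpos, h]⟩
  · rw [Nat.card_eq_zero]
    exact Or.inl ⟨fun w => h (by rw [← w.2.2, hpos])⟩

theorem walkCount_of_notMem {n : ℕ} {ι : Type*} {C : Set (Fin n → ℝ)} (step : ι → Fin n → ℝ)
    (a : Fin n → ℝ) {b : Fin n → ℝ} (hb : b ∉ C) (k : ℕ) : walkCount C step a b k = 0 := by
  rw [walkCount, Nat.card_eq_zero]
  exact Or.inl ⟨fun w => hb (by rw [← w.2.2]; exact w.2.1 k le_rfl)⟩

theorem walkCount_succ {n : ℕ} {ι : Type*} [Fintype ι] {C : Set (Fin n → ℝ)}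
    (step : ι → Fin n → ℝ) (a : Fin n → ℝ) {b : Fin n → ℝ} (hb : b ∈ C) (k : ℕ) :
    walkCount C step a b (k + 1) = ∑ e, walkCount C step a (b - step e) k := by
  unfold walkCount
  rw [← Nat.card_sigma]
  symm
  refine Nat.card_congr (Equiv.ofBijective (fun p => ⟨Fin.snoc p.2.1 p.1, ?_, ?_⟩) ⟨?_, ?_⟩)
  · intro t ht
    rcases Nat.le_succ_iff.1 ht with ht | rfl
    · rw [position_snoc _ _ _ _ ht]
      exact p.2.2.1 t ht
    · rw [position_snoc_last, p.2.2.2, sub_add_cancel]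
      exact hb
  · rw [position_snoc_last, p.2.2.2, sub_add_cancel]
  · rintro ⟨e, w, hw⟩ ⟨e', w', hw'⟩ h
    obtain ⟨rfl, rfl⟩ := Fin.snoc_injective2 (α := fun _ => ι) (congrArg Subtype.val h)
    rfl
  · rintro ⟨w, hw, hw'⟩
    refine ⟨⟨w (Fin.last k), Fin.init w, fun t ht => ?_, ?_⟩, Subtype.ext (Fin.snoc_init_self w)⟩
    · have := hw t (ht.trans k.le_succ)
      rw [← Fin.snoc_init_self w] at this
      rwa [position_snoc _ _ _ _ ht] at this
    · rw [← Fin.snoc_init_self w, position_snoc_last] at hw'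
      exact eq_sub_of_add_eq hw'

/-! ### Determinantal plane waves -/

/-- The antisymmetrized plane wave: the determinant of the characters
`ζ^{-(u + nρ_j)(λ_j - η_i - c)}`, `ζ = exp(2πi/(mn))`, as a function of `λ = lam`. The `j`-th
coordinate of `lam` has the momentum `u + n ρ_j`, and `c` translates `eta` along `(1, …, 1)`. -/
noncomputable def wave (n m u c : ℕ) (eta : Fin n → ℝ) (ρ : Fin n → ℕ) (lam : Fin n → ℝ) : ℂ :=
  (Matrix.of fun i j : Fin n =>
    zetaPow (m * n) (-(((u : ℝ) + n * ρ j) * (lam j - eta i - c)))).det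

theorem wave_sub {n : ℕ} (m u c : ℕ) (eta : Fin n → ℝ) (ρ : Fin n → ℕ) (lam v : Fin n → ℝ) :
    wave n m u c eta ρ (lam - v) =
      (∏ j, zetaPow (m * n) (((u : ℝ) + n * ρ j) * v j)) * wave n m u c eta ρ lam := by
  rw [wave, wave, ← Matrix.det_mul_row]
  congr 1
  ext i j
  simp only [Matrix.of_apply, Pi.sub_apply]
  rw [← zetaPow_add]
  congr 1
  ring

/-- Exchanging two momenta changes the sign of a wave at the points where the two corresponding
coordinates differ by a multiple of `m`: all momenta are congruent modulo `n`, so a translation of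
any coordinate by `m` has the same effect. -/
theorem wave_comp_swap {n m : ℕ} (hm : 0 < m) (u c : ℕ) (eta : Fin n → ℝ) (ρ : Fin n → ℕ)
    {lam : Fin n → ℝ} {i j : Fin n} (hij : i ≠ j) {e : ℤ} (h : lam i = lam j + m * e) :
    wave n m u c eta (ρ ∘ Equiv.swap i j) lam = -wave n m u c eta ρ lam := by
  have hn : 0 < n := i.pos
  -- `lam` and `lam ∘ swap i j` differ by `m * d`, where `d = e * (1_i - 1_j)`
  set d : Fin n → ℤ := fun l => if l = i then e else if l = j then -e else 0 with hd
  have hlam : ∀ l, lam l = lam (Equiv.swap i j l) + m * d l := by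
    intro l
    by_cases hli : l = i
    · simp [hd, hli, h]
    · by_cases hlj : l = j
      · simp [hd, hlj, hij.symm, h]
      · simp [hd, hli, hlj, Equiv.swap_apply_of_ne_of_ne hli hlj]
  have hsum : ∑ l, d l = 0 := by
    have : d = Pi.single i e + Pi.single j (-e) := by
      funext l
      by_cases hli : l = i
      · subst hli; simp [hd, hij]
      · by_cases hlj : l = j
        · subst hlj; simp [hd, hij.symm]
        · simp [hd, hli, hlj]
    simp [this, Finset.sum_add_distrib]
  have hprod : ∏ l, zetaPow (m * n) (-(((u : ℝ) + n * ρ (Equiv.swap i j l)) * (m * d l))) = 1 := by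
    have : ∀ l, zetaPow (m * n) (-(((u : ℝ) + n * ρ (Equiv.swap i j l)) * (m * d l))) =
        zetaPow n (-(u * d l)) := by
      intro l
      rw [show -(((u : ℝ) + n * ρ (Equiv.swap i j l)) * (m * d l)) =
        m * (-(u * d l) + ((-(n * ρ (Equiv.swap i j l) * d l) : ℤ) : ℝ)) by push_cast; ring,
        zetaPow_mul_mul hm, zetaPow_add, (zetaPow_intCast_eq_one_iff hn _).2, mul_one]
      exact (dvd_neg).2 ((dvd_mul_right _ _).mul_right _)
    simp_rw [this]
    rw [← zetaPow_sum, Finset.sum_neg_distrib, ← Finset.mul_sum, ← Int.cast_sum, hsum]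
    simp [zetaPow_zero]
  have key : wave n m u c eta (ρ ∘ Equiv.swap i j) lam =
      (Matrix.of fun k l => zetaPow (m * n)
        (-(((u : ℝ) + n * ρ (Equiv.swap i j l)) * (m * d l))) *
        ((Matrix.of fun i j : Fin n => zetaPow (m * n)
          (-(((u : ℝ) + n * ρ j) * (lam j - eta i - c)))).submatrix id (Equiv.swap i j)) k l).det := by
    rw [wave]
    congr 1
    ext k l
    simp only [Matrix.of_apply, Matrix.submatrix_apply, Function.comp_apply, id]
    rw [← zetaPow_add, hlam l]
    congr 1
    ring
  rw [key, Matrix.det_mul_row, hprod, one_mul, Matrix.det_permute', Equiv.Perm.sign_swap hij, wave]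
  simp

/-- Column-wise expansion of a determinant of superpositions of characters into waves. -/
theorem det_sum_zetaPow (n m u c R : ℕ) (eta lam : Fin n → ℝ) (w : ℂ) (g : ℕ → ℂ) :
    (Matrix.of fun i j : Fin n => w * ∑ r ∈ Finset.range R,
      zetaPow (m * n) (-(((u : ℝ) + n * r) * (lam j - eta i - c))) * g r).det =
    ∑ ρ ∈ Fintype.piFinset fun _ : Fin n => Finset.range R,
      (∏ j, g (ρ j)) * (w ^ n * wave n m u c eta ρ lam) := by
  have h := (Matrix.detRowAlternating (n := Fin n) (R := ℂ)).toMultilinearMap.map_sum_finset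
    (fun j r i => (w * g r) * zetaPow (m * n) (-(((u : ℝ) + n * r) * (lam j - eta i - c))))
    (fun _ => Finset.range R)
  have h2 : ∀ M : Fin n → Fin n → ℂ,
      (Matrix.detRowAlternating (n := Fin n) (R := ℂ)).toMultilinearMap M =
        (Matrix.of fun i j => M j i).det := fun M => (Matrix.det_transpose (Matrix.of M)).symm
  rw [h2] at h
  simp_rw [h2] at h
  convert h using 1
  · congr 1
    ext i j
    simp only [Matrix.of_apply, Finset.sum_apply, Finset.mul_sum]
    exact Finset.sum_congr rfl fun r _ => by ring
  · refine Finset.sum_congr rfl fun ρ _ => ?_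
    have := Matrix.det_mul_row (fun j => w * g (ρ j)) (Matrix.of fun i j : Fin n =>
      zetaPow (m * n) (-(((u : ℝ) + n * ρ j) * (lam j - eta i - c))))
    simp only [Matrix.of_apply] at this
    rw [this, wave, Finset.prod_mul_distrib, Finset.prod_const, Finset.card_univ, Fintype.card_fin]
    ring

/-- Superposition of all waves with momenta `u + nρ_j`, `0 ≤ ρ_j < R`, each weighted by the `k`-th
power of its eigenvalue `μ u ρ`. -/
noncomputable def waveSum (n m R : ℕ) (μ : ℕ → (Fin n → ℕ) → ℂ) (eta : Fin n → ℝ) (k : ℕ)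
    (lam : Fin n → ℝ) : ℂ :=
  ∑ c ∈ Finset.range m, (1 / (n : ℂ)) * ∑ u ∈ Finset.range n,
    ∑ ρ ∈ Fintype.piFinset fun _ : Fin n => Finset.range R,
      μ u ρ ^ k * ((1 / (R : ℂ)) ^ n * wave n m u c eta ρ lam)

/-- Each wave is an eigenfunction of the transfer operator of an unrestricted walk, so their
superposition satisfies the recurrence of that walk. -/
theorem waveSum_succ {n m R : ℕ} {ι : Type*} [Fintype ι] {step : ι → Fin n → ℝ}
    {μ : ℕ → (Fin n → ℕ) → ℂ}
    (hμ : ∀ (u : ℕ) (ρ : Fin n → ℕ), ∑ e, ∏ j, zetaPow (m * n) (((u : ℝ) + n * ρ j) * step e j) = μ u ρ)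
    (eta : Fin n → ℝ) (k : ℕ) (lam : Fin n → ℝ) :
    waveSum n m R μ eta (k + 1) lam = ∑ e, waveSum n m R μ eta k (lam - step e) := by
  unfold waveSum
  conv_rhs => rw [Finset.sum_comm]
  refine Finset.sum_congr rfl fun c _ => ?_
  conv_rhs => rw [← Finset.mul_sum, Finset.sum_comm]
  congr 1
  refine Finset.sum_congr rfl fun u _ => ?_
  conv_rhs => rw [Finset.sum_comm]
  refine Finset.sum_congr rfl fun ρ _ => ?_
  simp_rw [wave_sub]
  rw [← Finset.mul_sum, ← Finset.mul_sum, ← Finset.sum_mul, hμ]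
  ring

/-- The reflection principle: the superposition vanishes on the walls of the affine Weyl group. -/
theorem waveSum_eq_zero {n m R : ℕ} (hm : 0 < m) {μ : ℕ → (Fin n → ℕ) → ℂ}
    (hμ : ∀ u ρ (σ : Equiv.Perm (Fin n)), μ u (ρ ∘ σ) = μ u ρ) (eta : Fin n → ℝ) (k : ℕ)
    {lam : Fin n → ℝ} {i j : Fin n} (hij : i ≠ j) {e : ℤ} (h : lam i = lam j + m * e) :
    waveSum n m R μ eta k lam = 0 := by
  refine Finset.sum_eq_zero fun c _ => mul_eq_zero_of_right _ (Finset.sum_eq_zero fun u _ => ?_)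
  refine self_eq_neg.1 ?_
  rw [← Finset.sum_neg_distrib]
  refine Finset.sum_nbij' (fun ρ => ρ ∘ Equiv.swap i j) (fun ρ => ρ ∘ Equiv.swap i j) ?_ ?_ ?_ ?_ ?_
  · intro ρ hρ
    rw [Fintype.mem_piFinset] at hρ ⊢
    exact fun l => hρ _
  · intro ρ hρ
    rw [Fintype.mem_piFinset] at hρ ⊢
    exact fun l => hρ _
  · intro ρ _
    funext l
    simp
  · intro ρ _
    funext l
    simp
  · intro ρ _
    rw [hμ, wave_comp_swap hm u c eta ρ hij h]
    ring

theorem prod_ite_zero_of_forall {ι : Type*} [Fintype ι] (p : ι → Prop) [DecidablePred p]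
    [Decidable (∀ i, p i)] (f : ι → ℂ) :
    ∏ i, (if p i then f i else 0) = if ∀ i, p i then ∏ i, f i else 0 := by
  split_ifs with h
  · exact Finset.prod_congr rfl fun i _ => if_pos (h i)
  · push Not at h
    obtain ⟨i, hi⟩ := h
    exact Finset.prod_eq_zero (Finset.mem_univ i) (if_neg hi)

open Classical in
/-- Fourier inversion in all momenta: for `k = 0` the superposition counts, with signs, the
elements of the affine Weyl group (extended by multiples of `(1, …, 1)`) which carry `eta` to
`lam`. -/
theorem waveSum_zero {n m R : ℕ} (hn : 0 < n) (hm : 0 < m) (hR : 0 < R) (hmR : m ∣ R)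
    (μ : ℕ → (Fin n → ℕ) → ℂ) (eta lam : Fin n → ℝ) (Z : Fin n → Fin n → ℤ)
    (hZ : ∀ i j, lam j - eta i = Z i j) :
    waveSum n m R μ eta 0 lam = ∑ c ∈ Finset.range m, ∑ σ : Equiv.Perm (Fin n),
      if ∃ v : Fin n → ℤ, (∀ j, Z (σ j) j - c = m * v j) ∧ (n : ℤ) ∣ ∑ j, v j then
        ((Equiv.Perm.sign σ : ℤ) : ℂ) else 0 := by
  have hR' : (R : ℂ) ≠ 0 := by exact_mod_cast hR.ne'
  have hn' : (n : ℂ) ≠ 0 := by exact_mod_cast hn.ne'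
  refine Finset.sum_congr rfl fun c _ => ?_
  have hdet : ∀ u : ℕ, ∑ ρ ∈ Fintype.piFinset fun _ : Fin n => Finset.range R,
      μ u ρ ^ 0 * ((1 / (R : ℂ)) ^ n * wave n m u c eta ρ lam) =
      ∑ σ : Equiv.Perm (Fin n), ((Equiv.Perm.sign σ : ℤ) : ℂ) *
        if ∀ j, (m : ℤ) ∣ Z (σ j) j - c then
          ∏ j, zetaPow (m * n) (-(u * ((Z (σ j) j - c : ℤ) : ℝ))) else 0 := by
    intro u
    have := det_sum_zetaPow n m u c R eta lam (1 / (R : ℂ)) (fun _ => 1)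
    simp only [mul_one, Finset.prod_const_one, one_mul] at this
    simp only [pow_zero, one_mul]
    rw [← this, Matrix.det_apply']
    refine Finset.sum_congr rfl fun σ _ => ?_
    congr 1
    rw [← prod_ite_zero_of_forall]
    refine Finset.prod_congr rfl fun j _ => ?_
    simp only [Matrix.of_apply]
    have harg : ∀ r : ℕ, zetaPow (m * n) (-(((u : ℝ) + n * r) * (lam j - eta (σ j) - c))) =
        zetaPow (m * n) (-(u * ((Z (σ j) j - c : ℤ) : ℝ))) *
          zetaPow m (-(r * ((Z (σ j) j - c : ℤ) : ℝ))) := by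
      intro r
      rw [← zetaPow_mul_mul hn m, mul_comm n m, ← zetaPow_add, hZ]
      congr 1
      push_cast
      ring
    simp_rw [harg]
    rw [← Finset.mul_sum, sum_range_zetaPow hm hmR]
    split_ifs
    · field_simp
    · simp
  simp_rw [hdet]
  rw [Finset.sum_comm, Finset.mul_sum]
  refine Finset.sum_congr rfl fun σ _ => ?_
  rw [← Finset.mul_sum]
  by_cases h : ∀ j, (m : ℤ) ∣ Z (σ j) j - c
  · choose v hv using h
    have hm' : (m : ℤ) ≠ 0 := by exact_mod_cast hm.ne'
    have hex : (∃ v : Fin n → ℤ, (∀ j, Z (σ j) j - c = m * v j) ∧ (n : ℤ) ∣ ∑ j, v j) ↔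
        (n : ℤ) ∣ ∑ j, v j := by
      refine ⟨fun ⟨v', hv', hd⟩ => ?_, fun h => ⟨v, hv, h⟩⟩
      have : v' = v := funext fun j => mul_left_cancel₀ hm' ((hv' j).symm.trans (hv j))
      rwa [this] at hd
    have hu : ∀ u : ℕ, (if ∀ j, (m : ℤ) ∣ Z (σ j) j - c then
          ∏ j, zetaPow (m * n) (-(u * ((Z (σ j) j - c : ℤ) : ℝ))) else 0) =
        zetaPow n (-(u * ((∑ j, v j : ℤ) : ℝ))) := by
      intro u
      rw [if_pos fun j => ⟨v j, hv j⟩, ← zetaPow_sum, ← zetaPow_mul_mul hm n]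
      congr 1
      simp_rw [hv]
      push_cast
      rw [Finset.sum_neg_distrib, ← Finset.mul_sum, ← Finset.mul_sum]
      ring
    simp_rw [hu, sum_range_zetaPow hn dvd_rfl, hex]
    split_ifs
    · field_simp
    · simp
  · have hex : ¬ ∃ v : Fin n → ℤ, (∀ j, Z (σ j) j - c = m * v j) ∧ (n : ℤ) ∣ ∑ j, v j :=
      fun ⟨v, hv, _⟩ => h fun j => ⟨v j, hv j⟩
    simp [h, hex]

theorem waveSum_zero_eq_ite {n m R : ℕ} (hn : 0 < n) (hm : 0 < m) (hR : 0 < R) (hmR : m ∣ R)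
    (μ : ℕ → (Fin n → ℕ) → ℂ) {eta lam : Fin n → ℝ} (heta : proj eta ∈ alcove n m)
    (hlam : proj lam ∈ alcove n m) (hZ : ∀ i j, ∃ z : ℤ, lam j - eta i = z)
    [Decidable (proj eta = proj lam)] :
    waveSum n m R μ eta 0 lam = if proj eta = proj lam then 1 else 0 := by
  classical
  choose Z hZ using hZ
  rw [waveSum_zero hn hm hR hmR μ eta lam Z hZ]
  have hn' : (n : ℤ) ≠ 0 := by exact_mod_cast hn.ne'
  have hfund : ∀ (c : ℕ) (σ : Equiv.Perm (Fin n)),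
      (∃ v : Fin n → ℤ, (∀ j, Z (σ j) j - c = m * v j) ∧ (n : ℤ) ∣ ∑ j, v j) →
      σ = 1 ∧ ∃ q : ℤ, ∀ j, lam j = eta j + (c + m * q) := by
    rintro c σ ⟨v, hv, q, hq⟩
    obtain ⟨h1, h2⟩ := eq_of_affine_congruent hlam heta σ v q c hq fun j => by
      have := congrArg (Int.cast (R := ℝ)) (hv j)
      push_cast at this
      rw [← hZ] at this
      linarith
    exact ⟨h1, q, h2⟩
  split_ifs with h
  · obtain ⟨t, ht⟩ := (proj_eq_proj_iff hn _ _).1 h.symm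
    obtain ⟨z, hz⟩ : ∃ z : ℤ, t = z := ⟨Z ⟨0, hn⟩ ⟨0, hn⟩, by rw [← hZ, ht]; ring⟩
    have hm' : (0 : ℤ) < m := by exact_mod_cast hm
    have hc : ((z % m).toNat : ℤ) = z % m := Int.toNat_of_nonneg (Int.emod_nonneg _ hm'.ne')
    -- only the translation `c ≡ t` modulo `m` and the identity permutation contribute
    rw [Finset.sum_eq_single_of_mem (z % m).toNat, Finset.sum_eq_single_of_mem 1
      (Finset.mem_univ _)]
    · rw [if_pos]
      · simp
      · refine ⟨fun _ => z / m, fun j => ?_, by simp⟩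
        have : Z j j = z := by
          have := hZ j j
          rw [ht, hz] at this
          have h3 : (Z j j : ℝ) = z := by linarith
          exact_mod_cast h3
        rw [Equiv.Perm.one_apply, this, hc, Int.emod_def]
        ring
    · intro σ _ hσ
      exact if_neg fun hv => hσ (hfund _ _ hv).1
    · rw [Finset.mem_range]
      have := Int.emod_lt_of_pos z hm'
      omega
    · intro c hc' hne
      rw [Finset.mem_range] at hc'
      refine Finset.sum_eq_zero fun σ _ => if_neg fun hv => hne ?_
      obtain ⟨q, hq⟩ := (hfund _ _ hv).2
      have h1 := hq ⟨0, hn⟩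
      rw [ht, hz] at h1
      have h2 : (z : ℝ) = c + m * q := by linarith
      have h3 : z = c + m * q := by exact_mod_cast h2
      have h4 : z % m = c := by
        rw [h3, Int.add_mul_emod_self_left]
        exact Int.emod_eq_of_lt (by omega) (by omega)
      omega
  · refine Finset.sum_eq_zero fun c _ => Finset.sum_eq_zero fun σ _ => if_neg fun hv => h ?_
    obtain ⟨q, hq⟩ := (hfund _ _ hv).2
    exact ((proj_eq_proj_iff hn _ _).2 ⟨_, hq⟩).symm

/-- The transfer-matrix form of the reflection principle. Walks in the alcove and the superposition
of waves satisfy the same recurrence with the same initial values, and both vanish at the points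
just outside: since the coordinates of a step differ by integers of absolute value at most one, a
walk leaves the alcove only through a point on a wall. -/
theorem walkCount_eq_waveSum {n m R : ℕ} (hn : 0 < n) (hm : 0 < m) (hR : 0 < R) (hmR : m ∣ R)
    {ι : Type*} [Fintype ι] {step : ι → Fin n → ℝ} {μ : ℕ → (Fin n → ℕ) → ℂ} {δ : ℝ}
    (hstep : ∀ e j, ∃ z : ℤ, step e j = δ + z) (hle : ∀ e i j, step e i - step e j ≤ 1)
    (hμ : ∀ (u : ℕ) (ρ : Fin n → ℕ), ∑ e, ∏ j, zetaPow (m * n) (((u : ℝ) + n * ρ j) * step e j) = μ u ρ)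
    (hsymm : ∀ u ρ (σ : Equiv.Perm (Fin n)), μ u (ρ ∘ σ) = μ u ρ)
    {eta : Fin n → ℝ} (heta : proj eta ∈ alcove n m) (k : ℕ) {lam : Fin n → ℝ}
    (hlam : proj lam ∈ alcove n m) (hZ : ∀ i j, ∃ z : ℤ, lam j - eta i - k * δ = z) :
    (walkCount (alcove n m) (fun e => proj (step e)) (proj eta) (proj lam) k : ℂ) =
      waveSum n m R μ eta k lam := by
  classical
  induction k generalizing lam with
  | zero =>
    rw [walkCount_zero _ heta, waveSum_zero_eq_ite hn hm hR hmR μ heta hlam (by simpa using hZ)]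
    simp
  | succ k ih =>
    rw [walkCount_succ _ _ hlam, waveSum_succ hμ, Nat.cast_sum]
    refine Finset.sum_congr rfl fun e _ => ?_
    rw [← proj_sub]
    have hZ' : ∀ i j, ∃ z : ℤ, (lam - step e) j - eta i - k * δ = z := by
      intro i j
      obtain ⟨a, ha⟩ := hZ i j
      obtain ⟨b, hb⟩ := hstep e j
      refine ⟨a - b, ?_⟩
      rw [Pi.sub_apply, hb]
      push_cast at ha ⊢
      linarith
    have hint : ∀ i j, ∃ z : ℤ, lam i - lam j = z := by
      intro i j
      obtain ⟨a, ha⟩ := hZ i i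
      obtain ⟨b, hb⟩ := hZ i j
      exact ⟨a - b, by push_cast; linarith⟩
    have hint' : ∀ i j, ∃ z : ℤ, (lam - step e) i - (lam - step e) j = z := by
      intro i j
      obtain ⟨a, ha⟩ := hZ' i i
      obtain ⟨b, hb⟩ := hZ' i j
      exact ⟨a - b, by push_cast; linarith⟩
    -- crossing the wall `x i - x j = m * q` costs at least two units of integer length
    have hwall : ∀ (i j : Fin n) (q : ℤ), lam j + m * q < lam i →
        ¬ (lam - step e) j + m * q < (lam - step e) i →
        (lam - step e) i = (lam - step e) j + m * q := by
      intro i j q h1 h2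
      obtain ⟨a, ha⟩ := hint i j
      obtain ⟨b, hb⟩ := hint' i j
      have h3 := hle e i j
      have h4 : (m : ℝ) * q < a := by linarith
      have h5 : (m * q : ℤ) < a := by exact_mod_cast h4
      have h6 : (b : ℝ) ≤ m * q := by linarith
      have h7 : b ≤ (m * q : ℤ) := by exact_mod_cast h6
      have h8 : (a : ℝ) ≤ b + 1 := by
        simp only [Pi.sub_apply] at hb
        linarith
      have h9 : a ≤ b + 1 := by exact_mod_cast h8
      have h10 : (b : ℝ) = m * q := by
        have : b = m * q := by omega
        exact_mod_cast this
      linarith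
    by_cases h : proj (lam - step e) ∈ alcove n m
    · exact ih h hZ'
    · rw [walkCount_of_notMem _ _ h, Nat.cast_zero]
      rw [proj_mem_alcove_iff, not_and_or] at h
      rw [proj_mem_alcove_iff] at hlam
      symm
      rcases h with h | h
      · push Not at h
        obtain ⟨i, j, hij, hle'⟩ := h
        refine waveSum_eq_zero hm hsymm eta k hij.ne (e := 0) (hwall i j 0 ?_ ?_)
        · simpa using hlam.1 i j hij
        · simpa using hle'
      · push Not at h
        obtain ⟨h0, h⟩ := h
        have hm' : (0 : ℝ) < m := by exact_mod_cast hm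
        have hne : (⟨n - 1, Nat.sub_lt h0 one_pos⟩ : Fin n) ≠ ⟨0, h0⟩ := by
          intro heq
          rw [heq] at h
          linarith
        refine waveSum_eq_zero hm hsymm eta k hne (e := -1) (hwall _ _ (-1) ?_ ?_)
        · have := hlam.2 h0
          push_cast
          linarith
        · push_cast
          linarith

/-! ### Coordinate steps -/

/-- In the alcove the smallest coordinate is the last one, so the phase is trivial. -/
theorem succ_eq_of_forall_le {n m : ℕ} {lam : Fin n → ℝ} (hlam : proj lam ∈ alcove n m) {s : Fin n}
    (hs : ∀ i, lam s ≤ lam i) : (s : ℕ) + 1 = n := by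
  by_contra hne
  have hlt : (s : ℕ) + 1 < n := lt_of_le_of_ne s.2 hne
  have h1 := ((proj_mem_alcove_iff lam).1 hlam).1 s ⟨s + 1, hlt⟩ (Fin.lt_def.2 (Nat.lt_succ_self _))
  exact absurd (hs ⟨s + 1, hlt⟩) (not_le.2 h1)

theorem zetaPow_neg_mul_mul {n m : ℕ} (hn : 0 < n) (hm : 0 < m) (u : ℕ) :
    zetaPow (m * n) (-((u : ℝ) * m * n)) = 1 := by
  rw [show -((u : ℝ) * m * n) = ((-(u * m * n) : ℤ) : ℝ) by push_cast; ring,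
    zetaPow_intCast_eq_one_iff (Nat.mul_pos hm hn)]
  refine (dvd_neg).2 ⟨u, ?_⟩
  push_cast
  ring

/-- The sum of a wave's eigenvalues over the steps `± e_i`. -/
noncomputable def coordEigenvalue (n m u : ℕ) (ρ : Fin n → ℕ) : ℂ :=
  ∑ j, 2 * (Real.cos (2 * Real.pi * (u + n * ρ j) / (m * n)) : ℂ)

theorem sum_prod_zetaPow_coord (n m u : ℕ) (ρ : Fin n → ℕ) :
    ∑ e : Fin n × Bool, ∏ j, zetaPow (m * n) (((u : ℝ) + n * ρ j) *
      (Pi.single e.1 (if e.2 then 1 else -1) : Fin n → ℝ) j) = coordEigenvalue n m u ρ := by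
  rw [Fintype.sum_prod_type]
  refine Finset.sum_congr rfl fun i _ => ?_
  have h : ∀ a : ℝ, ∏ j, zetaPow (m * n) (((u : ℝ) + n * ρ j) * (Pi.single i a : Fin n → ℝ) j) =
      zetaPow (m * n) (((u : ℝ) + n * ρ i) * a) := by
    intro a
    rw [Finset.prod_eq_single i]
    · rw [Pi.single_eq_same]
    · intro j _ hj
      rw [Pi.single_eq_of_ne hj, mul_zero, zetaPow_zero]
    · simp
  simp_rw [h]
  rw [Fintype.sum_bool, if_pos rfl, if_neg Bool.false_ne_true, mul_one, mul_neg_one,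
    zetaPow_add_zetaPow_neg]
  push_cast
  ring_nf

theorem coordFormula_eq {n m : ℕ} (hn : 0 < n) (hm : 0 < m) (eta lam : Fin n → ℝ) (x : ℂ) :
    coordFormula n m n eta lam x =
      ∑ c ∈ Finset.range m, (1 / (n : ℂ)) * ∑ u ∈ Finset.range n,
        ∑ ρ ∈ Fintype.piFinset fun _ : Fin n => Finset.range m,
          Complex.exp (coordEigenvalue n m u ρ * x) *
            ((1 / (m : ℂ)) ^ n * wave n m u c eta ρ lam) := by
  unfold coordFormula
  refine Finset.sum_congr rfl fun c _ => ?_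
  congr 1
  refine Finset.sum_congr rfl fun u _ => ?_
  rw [zetaPow_neg_mul_mul hn hm, one_mul, det_sum_zetaPow n m u c m eta lam (1 / (m : ℂ))
    (fun r => Complex.exp (2 * x * (Real.cos (2 * Real.pi * (u + n * r) / (m * n)) : ℂ)))]
  refine Finset.sum_congr rfl fun ρ _ => ?_
  rw [← Complex.exp_sum, coordEigenvalue, Finset.sum_mul]
  congr 2
  exact Finset.sum_congr rfl fun j _ => by ring

theorem hasSum_waveSum_coord {n m : ℕ} (hn : 0 < n) (hm : 0 < m) (eta lam : Fin n → ℝ) (x : ℂ) :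
    HasSum (fun k : ℕ => waveSum n m m (coordEigenvalue n m) eta k lam * x ^ k / (k.factorial : ℂ))
      (coordFormula n m n eta lam x) := by
  rw [coordFormula_eq hn hm]
  have h : HasSum (fun k : ℕ => ∑ c ∈ Finset.range m, (1 / (n : ℂ)) * ∑ u ∈ Finset.range n,
      ∑ ρ ∈ Fintype.piFinset fun _ : Fin n => Finset.range m,
        (coordEigenvalue n m u ρ * x) ^ k / (k.factorial : ℂ) *
          ((1 / (m : ℂ)) ^ n * wave n m u c eta ρ lam)) _ :=
    hasSum_sum fun c _ => HasSum.mul_left _ <| hasSum_sum fun u _ => hasSum_sum fun ρ _ =>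
      (NormedSpace.expSeries_div_hasSum_exp (coordEigenvalue n m u ρ * x)).mul_right _
  rw [← Complex.exp_eq_exp_ℂ] at h
  convert h using 2 with k
  unfold waveSum
  rw [mul_div_assoc, Finset.sum_mul]
  refine Finset.sum_congr rfl fun c _ => ?_
  rw [mul_assoc, Finset.sum_mul]
  congr 1
  refine Finset.sum_congr rfl fun u _ => ?_
  rw [Finset.sum_mul]
  refine Finset.sum_congr rfl fun ρ _ => ?_
  rw [mul_pow]
  ring

theorem walkCount_coordStep {n m : ℕ} (hn : 0 < n) (hm : 0 < m) {eta lam : Fin n → ℝ}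
    (heta : proj eta ∈ alcove n m) (hlam : proj lam ∈ alcove n m)
    (hZ : ∀ i j, ∃ z : ℤ, lam j - eta i = z) (k : ℕ) :
    (walkCount (alcove n m) (coordStep n) (proj eta) (proj lam) k : ℂ) =
      waveSum n m m (coordEigenvalue n m) eta k lam := by
  refine walkCount_eq_waveSum hn hm hm dvd_rfl
    (step := fun e : Fin n × Bool => Pi.single e.1 (if e.2 then 1 else -1)) (δ := 0)
    ?_ ?_ (sum_prod_zetaPow_coord n m) ?_ heta k hlam (by simpa using hZ)
  · rintro ⟨i, b⟩ j
    refine ⟨(Pi.single i (if b then 1 else -1) : Fin n → ℤ) j, ?_⟩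
    by_cases h : j = i
    · subst h; cases b <;> simp
    · simp [h]
  · rintro ⟨i, b⟩ j l
    by_cases hj : j = i <;> by_cases hl : l = i <;> cases b <;> simp [hj, hl]
  · intro u ρ σ
    exact Equiv.sum_comp σ fun j => 2 * (Real.cos (2 * Real.pi * (u + n * ρ j) / (m * n)) : ℂ)

/-! ### Diagonal steps -/

/-- The sum of a wave's eigenvalues over the steps `(± 1/2, …, ± 1/2)`. -/
noncomputable def diagEigenvalue (n m u : ℕ) (ρ : Fin n → ℕ) : ℂ :=
  ∏ j, 2 * (Real.cos (Real.pi * (u + n * ρ j) / (m * n)) : ℂ)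

theorem sum_prod_zetaPow_diag (n m u : ℕ) (ρ : Fin n → ℕ) :
    ∑ ε : Fin n → Bool, ∏ j, zetaPow (m * n) (((u : ℝ) + n * ρ j) *
      (if ε j then 1 / 2 else -(1 / 2))) = diagEigenvalue n m u ρ := by
  have h := Fintype.prod_sum fun (j : Fin n) (b : Bool) =>
    zetaPow (m * n) (((u : ℝ) + n * ρ j) * (if b then 1 / 2 else -(1 / 2)))
  rw [← h]
  refine Finset.prod_congr rfl fun j _ => ?_
  rw [Fintype.sum_bool, if_pos rfl, if_neg Bool.false_ne_true, mul_neg, zetaPow_add_zetaPow_neg]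
  push_cast
  ring_nf

theorem diagFormula_eq {n m : ℕ} (hn : 0 < n) (hm : 0 < m) (eta lam : Fin n → ℝ) (k : ℕ) :
    diagFormula n m n eta lam k = waveSum n m (2 * m) (diagEigenvalue n m) eta k lam := by
  have htwo : ∀ a : ℝ, zetaPow (2 * m * n) (-(2 * a)) = zetaPow (m * n) (-a) := by
    intro a
    rw [← zetaPow_mul_mul two_pos (m * n), mul_assoc]
    push_cast
    ring_nf
  unfold diagFormula waveSum
  refine Finset.sum_congr rfl fun c _ => ?_
  congr 1
  refine Finset.sum_congr rfl fun u _ => ?_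
  have hphase : zetaPow (2 * m * n) (-(2 * (u : ℝ) * m * n)) = 1 := by
    rw [show 2 * (u : ℝ) * m * n = 2 * (u * m * n) by ring, htwo, zetaPow_neg_mul_mul hn hm]
  have h := det_sum_zetaPow n m u c (2 * m) eta lam (1 / ((2 * m : ℕ) : ℂ))
    (fun r => (2 * (Real.cos (Real.pi * (u + n * r) / (m * n)) : ℂ)) ^ k)
  rw [hphase, one_mul]
  convert h using 1
  · congr 1
    ext i j
    simp only [Matrix.of_apply]
    rw [Finset.mul_sum, Finset.mul_sum]
    refine Finset.sum_congr rfl fun r _ => ?_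
    rw [mul_assoc 2 ((u : ℝ) + n * r), htwo, mul_pow]
    push_cast
    ring
  · refine Finset.sum_congr rfl fun ρ _ => ?_
    rw [diagEigenvalue, Finset.prod_pow]

theorem walkCount_diagStep {n m : ℕ} (hn : 0 < n) (hm : 0 < m) {eta lam : Fin n → ℝ} (k : ℕ)
    (heta : proj eta ∈ alcove n m) (hlam : proj lam ∈ alcove n m)
    (hZ : ∀ i j, ∃ z : ℤ, lam j - eta i - (k : ℝ) / 2 = z) :
    (walkCount (alcove n m) (diagStep n) (proj eta) (proj lam) k : ℂ) =
      waveSum n m (2 * m) (diagEigenvalue n m) eta k lam := by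
  refine walkCount_eq_waveSum hn hm (Nat.mul_pos two_pos hm) (Dvd.intro_left 2 rfl)
    (step := fun (ε : Fin n → Bool) i => if ε i then 1 / 2 else -(1 / 2)) (δ := 1 / 2)
    ?_ ?_ (sum_prod_zetaPow_diag n m) ?_ heta k hlam ?_
  · intro ε j
    refine ⟨if ε j then 0 else -1, ?_⟩
    split_ifs <;> norm_num
  · intro ε i j
    split_ifs <;> norm_num
  · intro u ρ σ
    exact Equiv.prod_comp σ fun j => 2 * (Real.cos (Real.pi * (u + n * ρ j) / (m * n)) : ℂ)
  · intro i j
    obtain ⟨z, hz⟩ := hZ i j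
    exact ⟨z, by rw [← hz]; ring⟩

/-! ### Step sets as Weyl orbits of fundamental weights -/

theorem coordStep_true_apply (n : ℕ) (i j : Fin n) :
    coordStep n (i, true) j = (if j = i then 1 else 0) - 1 / n := by
  simp [coordStep, proj, Pi.single_apply]

theorem coordStep_false_apply (n : ℕ) (i j : Fin n) :
    coordStep n (i, false) j = 1 / n - (if j = i then 1 else 0) := by
  simp only [coordStep, proj, Bool.false_eq_true, if_false, Pi.single_apply, Finset.sum_ite_eq',
    Finset.mem_univ, if_true]
  split_ifs <;> ring

theorem fundWeight_apply {n : ℕ} (p : ℕ) (i : Fin n) :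
    fundWeight n p i = (if (i : ℕ) < p then 1 else 0) - (p : ℝ) / n := by
  have hn : (n : ℝ) ≠ 0 := by exact_mod_cast i.pos.ne'
  unfold fundWeight
  split_ifs
  · field_simp
  · ring

/-- A family of vectors indexed by `Fin n`, whose members single out one coordinate, is the orbit
of each of its members. -/
theorem range_eq_weylOrbit {n : ℕ} (f : Fin n → Fin n → ℝ) (a b : ℝ)
    (hf : ∀ i j, f i j = if j = i then a else b) {v : Fin n → ℝ} (i₀ : Fin n)
    (hv : ∀ j, v j = f i₀ j) : Set.range f = weylOrbit v := by
  obtain rfl : v = f i₀ := funext hv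
  ext w
  constructor
  · rintro ⟨i, rfl⟩
    refine ⟨Equiv.swap i i₀, ?_⟩
    funext j
    simp only [Function.comp_apply, hf]
    exact if_congr (by rw [Equiv.swap_apply_eq_iff, Equiv.swap_apply_right]) rfl rfl
  · rintro ⟨σ, rfl⟩
    refine ⟨σ.symm i₀, ?_⟩
    funext j
    simp only [Function.comp_apply, hf]
    exact if_congr (Equiv.eq_symm_apply σ) rfl rfl

theorem range_coordStep_true {n : ℕ} (hn : 0 < n) :
    Set.range (fun i : Fin n => coordStep n (i, true)) = weylOrbit (fundWeight n 1) := by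
  refine range_eq_weylOrbit _ (1 - 1 / n) (0 - 1 / n) ?_ ⟨0, hn⟩ ?_
  · intro i j
    rw [coordStep_true_apply]
    split_ifs <;> rfl
  · intro j
    rw [coordStep_true_apply, fundWeight_apply, Nat.cast_one]
    congr 1
    exact if_congr (by rw [Fin.ext_iff, Nat.lt_one_iff]) rfl rfl

theorem range_coordStep_false {n : ℕ} (hn : 0 < n) :
    Set.range (fun i : Fin n => coordStep n (i, false)) = weylOrbit (fundWeight n (n - 1)) := by
  have hn' : (n : ℝ) ≠ 0 := by exact_mod_cast hn.ne'
  refine range_eq_weylOrbit _ (1 / n - 1 : ℝ) (1 / n - 0) ?_ ⟨n - 1, Nat.sub_lt hn one_pos⟩ ?_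
  · intro i j
    rw [coordStep_false_apply]
    split_ifs <;> rfl
  · intro j
    rw [coordStep_false_apply, fundWeight_apply, Nat.cast_sub hn, Nat.cast_one, sub_div,
      div_self hn']
    have := j.2
    simp only [Fin.ext_iff]
    split_ifs <;> first | omega | ring

/-- The number of positive coordinates of a diagonal step. -/
def trueCount {n : ℕ} (ε : Fin n → Bool) : ℕ := Fintype.card {i // ε i = true}

theorem diagStep_apply {n : ℕ} (ε : Fin n → Bool) (i : Fin n) :
    diagStep n ε i = (if ε i then 1 else 0) - (trueCount ε : ℝ) / n := by
  have hn : (n : ℝ) ≠ 0 := by exact_mod_cast i.pos.ne'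
  have h : ∀ j, (if ε j then (1 / 2 : ℝ) else -(1 / 2)) = (if ε j then 1 else 0) - 1 / 2 := by
    intro j
    split_ifs <;> norm_num
  have hcard : ∑ j, (if ε j then (1 : ℝ) else 0) = trueCount ε := by
    rw [Finset.sum_boole, trueCount, Fintype.card_subtype]
  simp only [diagStep, proj, h, Finset.sum_sub_distrib, hcard, Finset.sum_const,
    Finset.card_univ, Fintype.card_fin, nsmul_eq_mul]
  field_simp
  ring

theorem diagStep_eq_iff {n : ℕ} (ε ε' : Fin n → Bool) :
    diagStep n ε = diagStep n ε' ↔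
      ε = ε' ∨ (∃ b, ∀ i, ε i = b) ∧ ∃ b, ∀ i, ε' i = b := by
  constructor
  · intro h
    have hi : ∀ i j, (if ε i then (1 : ℤ) else 0) - (if ε' i then 1 else 0) =
        (if ε j then 1 else 0) - (if ε' j then 1 else 0) := by
      intro i j
      have h1 := congrFun h i
      have h2 := congrFun h j
      simp only [diagStep_apply] at h1 h2
      have : (if ε i then (1 : ℝ) else 0) - (if ε' i then 1 else 0) =
        (if ε j then 1 else 0) - (if ε' j then 1 else 0) := by linarith
      exact_mod_cast this
    by_cases heq : ε = ε'
    · exact Or.inl heq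
    · obtain ⟨i, hne⟩ := Function.ne_iff.1 heq
      -- a nonzero constant difference of two `0`-`1`-valued functions determines both
      refine Or.inr ⟨⟨ε i, fun j => ?_⟩, ⟨ε' i, fun j => ?_⟩⟩ <;>
      · have := hi i j
        revert this hne
        cases ε i <;> cases ε' i <;> cases ε j <;> cases ε' j <;> simp
  · rintro (rfl | ⟨⟨b, hb⟩, ⟨b', hb'⟩⟩)
    · rfl
    · funext i
      have hn : (n : ℝ) ≠ 0 := by exact_mod_cast i.pos.ne'
      have : ∀ (δ : Fin n → Bool) b, (∀ i, δ i = b) → diagStep n δ i = 0 := by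
        intro δ b hb
        rw [diagStep_apply, trueCount, Fintype.card_subtype]
        cases b <;> simp [hb, hn]
      rw [this ε b hb, this ε' b' hb']

theorem diagStep_const (n : ℕ) (b : Bool) : diagStep n (fun _ => b) = 0 := by
  funext i
  have hn : (n : ℝ) ≠ 0 := by exact_mod_cast i.pos.ne'
  rw [diagStep_apply, trueCount, Fintype.card_subtype]
  cases b <;> simp [hn]

theorem diagStep_eq_zero_iff {n : ℕ} (ε : Fin n → Bool) :
    diagStep n ε = 0 ↔ ∃ b, ∀ i, ε i = b := by
  rw [← diagStep_const n true, diagStep_eq_iff]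
  constructor
  · rintro (rfl | ⟨h, -⟩)
    · exact ⟨true, fun _ => rfl⟩
    · exact h
  · exact fun h => Or.inr ⟨h, true, fun _ => rfl⟩

theorem card_diagStep_eq_zero {n : ℕ} (hn : 0 < n) :
    Nat.card {ε : Fin n → Bool // diagStep n ε = 0} = 2 := by
  rw [← Nat.card_eq_fintype_card.trans Fintype.card_bool]
  symm
  refine Nat.card_congr (Equiv.ofBijective (fun b => ⟨fun _ => b, diagStep_const n b⟩) ⟨?_, ?_⟩)
  · intro b b' h
    exact congrFun (congrArg Subtype.val h) ⟨0, hn⟩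
  · rintro ⟨ε, hε⟩
    obtain ⟨b, hb⟩ := (diagStep_eq_zero_iff ε).1 hε
    exact ⟨b, Subtype.ext (funext fun i => (hb i).symm)⟩

theorem trueCount_perm {n p : ℕ} (hpn : p ≤ n) (σ : Equiv.Perm (Fin n)) :
    trueCount (fun i => decide ((σ i : ℕ) < p)) = p := by
  have e : {i // decide ((σ i : ℕ) < p) = true} ≃ {i : Fin n // (i : ℕ) < p} :=
    σ.subtypeEquiv fun i => by simp
  rw [trueCount, Fintype.card_congr e, Fintype.card_subtype, Fin.card_filter_val_lt,
    min_eq_right hpn]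

theorem fundWeight_comp_perm {n p : ℕ} (hpn : p ≤ n) (σ : Equiv.Perm (Fin n)) :
    fundWeight n p ∘ σ = diagStep n (fun i => decide ((σ i : ℕ) < p)) := by
  funext i
  rw [Function.comp_apply, fundWeight_apply, diagStep_apply, trueCount_perm hpn]
  simp

theorem exists_perm_of_trueCount {n : ℕ} (ε : Fin n → Bool) :
    ∃ σ : Equiv.Perm (Fin n), ε = fun i => decide ((σ i : ℕ) < trueCount ε) := by
  have hle : trueCount ε ≤ n := (Fintype.card_subtype_le _).trans_eq (Fintype.card_fin n)
  have hcard : Fintype.card {i // ε i = true} =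
      Fintype.card {i : Fin n // (i : ℕ) < trueCount ε} := by
    rw [Fintype.card_subtype (fun i : Fin n => (i : ℕ) < trueCount ε), Fin.card_filter_val_lt,
      min_eq_right hle, trueCount]
  refine ⟨(Fintype.equivOfCardEq hcard).extendSubtype, funext fun i => ?_⟩
  by_cases h : ε i = true
  · rw [h, eq_comm, decide_eq_true_iff]
    exact Equiv.extendSubtype_mem (Fintype.equivOfCardEq hcard) i h
  · rw [Bool.eq_false_iff.2 h, eq_comm, decide_eq_false_iff_not]
    exact Equiv.extendSubtype_not_mem (Fintype.equivOfCardEq hcard) i h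

theorem range_diagStep (n : ℕ) :
    Set.range (diagStep n) = {0} ∪ ⋃ p ∈ Set.Ioo 0 n, weylOrbit (fundWeight n p) := by
  ext v
  simp only [Set.mem_union, Set.mem_singleton_iff, Set.mem_iUnion, exists_prop]
  constructor
  · rintro ⟨ε, rfl⟩
    by_cases h : diagStep n ε = 0
    · exact Or.inl h
    · obtain ⟨σ, hσ⟩ := exists_perm_of_trueCount ε
      have hle : trueCount ε ≤ n := (Fintype.card_subtype_le _).trans_eq (Fintype.card_fin n)
      have hconst := mt (diagStep_eq_zero_iff ε).2 h
      refine Or.inr ⟨trueCount ε, ⟨?_, lt_of_le_of_ne hle ?_⟩, σ, ?_⟩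
      · refine Nat.pos_of_ne_zero fun h0 => hconst ⟨false, fun i => ?_⟩
        rw [h0] at hσ
        rw [hσ]
        simp
      · intro h0
        refine hconst ⟨true, fun i => ?_⟩
        rw [h0] at hσ
        rw [hσ]
        simp
      · dsimp only
        rw [fundWeight_comp_perm hle, ← hσ]
  · rintro (rfl | ⟨p, hp, σ, rfl⟩)
    · exact ⟨_, diagStep_const n true⟩
    · exact ⟨_, (fundWeight_comp_perm hp.2.le σ).symm⟩

theorem card_diagStep_eq {n p : ℕ} (hp : p ∈ Set.Ioo 0 n) {v : Fin n → ℝ}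
    (hv : v ∈ weylOrbit (fundWeight n p)) :
    Nat.card {ε : Fin n → Bool // diagStep n ε = v} = 1 := by
  obtain ⟨σ, rfl⟩ := hv
  dsimp only
  rw [fundWeight_comp_perm hp.2.le, Nat.card_eq_one_iff_unique]
  refine ⟨⟨?_⟩, ⟨⟨_, rfl⟩⟩⟩
  have hnc : ¬ ∃ b, ∀ i, (fun i => decide ((σ i : ℕ) < p)) i = b := by
    rintro ⟨b, hb⟩
    have h0 := hb (σ.symm ⟨0, hp.1.trans hp.2⟩)
    have h1 := hb (σ.symm ⟨p, hp.2⟩)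
    simp only [Equiv.apply_symm_apply, hp.1, decide_true, lt_irrefl, decide_false] at h0 h1
    exact absurd (h0.trans h1.symm) (by decide)
  have huniq : ∀ ε : Fin n → Bool, diagStep n ε = diagStep n (fun i => decide ((σ i : ℕ) < p)) →
      ε = fun i => decide ((σ i : ℕ) < p) := fun ε h =>
    ((diagStep_eq_iff _ _).1 h).resolve_right fun h' => hnc h'.2
  rintro ⟨ε, hε⟩ ⟨ε', hε'⟩
  exact Subtype.ext ((huniq ε hε).trans (huniq ε' hε').symm)

end AlcoveWalk

theorem mainTheorem5 (n m : ℕ) (hn : 0 < n) (hm : 0 < m) :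
    -- the projections of `e_i` and `-e_i` are the Weyl images of two fundamental weights
    (Set.range (fun i : Fin n => AlcoveWalk.coordStep n (i, true)) =
        AlcoveWalk.weylOrbit (AlcoveWalk.fundWeight n 1) ∧
      Set.range (fun i : Fin n => AlcoveWalk.coordStep n (i, false)) =
        AlcoveWalk.weylOrbit (AlcoveWalk.fundWeight n (n - 1))) ∧
    -- the projected diagonals are the Weyl images of all fundamental weights, each once,
    -- and the zero step, twice
    (Set.range (AlcoveWalk.diagStep n) =
        {0} ∪ ⋃ p ∈ Set.Ioo 0 n, AlcoveWalk.weylOrbit (AlcoveWalk.fundWeight n p) ∧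
      Nat.card {ε : Fin n → Bool // AlcoveWalk.diagStep n ε = 0} = 2 ∧
      ∀ p ∈ Set.Ioo 0 n, ∀ v ∈ AlcoveWalk.weylOrbit (AlcoveWalk.fundWeight n p),
        Nat.card {ε : Fin n → Bool // AlcoveWalk.diagStep n ε = v} = 1) ∧
    -- exponential generating function for the projected coordinate steps
    (∀ eta lam : Fin n → ℝ,
      AlcoveWalk.proj eta ∈ AlcoveWalk.alcove n m →
      AlcoveWalk.proj lam ∈ AlcoveWalk.alcove n m →
      (∀ i j, ∃ z : ℤ, lam j - eta i = z) →
      ∀ s : Fin n, (∀ i, lam s ≤ lam i) →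
      ∀ x : ℂ,
        HasSum (fun k : ℕ =>
          (AlcoveWalk.walkCount (AlcoveWalk.alcove n m) (AlcoveWalk.coordStep n)
            (AlcoveWalk.proj eta) (AlcoveWalk.proj lam) k : ℂ) * x ^ k / (k.factorial : ℂ))
          (AlcoveWalk.coordFormula n m (s + 1) eta lam x)) ∧
    -- number of walks for the projected diagonal steps
    (∀ (eta lam : Fin n → ℝ) (k : ℕ),
      AlcoveWalk.proj eta ∈ AlcoveWalk.alcove n m →
      AlcoveWalk.proj lam ∈ AlcoveWalk.alcove n m →
      (∀ i j, ∃ z : ℤ, lam j - eta i - (k : ℝ) / 2 = z) →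
      ∀ s : Fin n, (∀ i, lam s ≤ lam i) →
        (AlcoveWalk.walkCount (AlcoveWalk.alcove n m) (AlcoveWalk.diagStep n)
          (AlcoveWalk.proj eta) (AlcoveWalk.proj lam) k : ℂ) =
          AlcoveWalk.diagFormula n m (s + 1) eta lam k) := by
  refine ⟨⟨AlcoveWalk.range_coordStep_true hn, AlcoveWalk.range_coordStep_false hn⟩,
    ⟨AlcoveWalk.range_diagStep n, AlcoveWalk.card_diagStep_eq_zero hn,
      fun p hp v hv => AlcoveWalk.card_diagStep_eq hp hv⟩, ?_, ?_⟩
  · intro eta lam heta hlam hZ s hs x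
    rw [AlcoveWalk.succ_eq_of_forall_le hlam hs]
    simp_rw [AlcoveWalk.walkCount_coordStep hn hm heta hlam hZ]
    exact AlcoveWalk.hasSum_waveSum_coord hn hm eta lam x
  · intro eta lam k heta hlam hZ s hs
    rw [AlcoveWalk.succ_eq_of_forall_le hlam hs, AlcoveWalk.diagFormula_eq hn hm]
    exact AlcoveWalk.walkCount_diagStep hn hm k heta hlam hZ
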